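/- Let $Q$ be a finite-dimensional smooth manifold without boundary (Hausdorff, second countable), with tangent bundle $TQ$ and cotangent bundle $\pi:T^*Q\to Q$. Let $\vartheta_0$ be the fundamental one-form on $T^*Q$, $\vartheta_0(p)(u)=\langle p,d\pi(u)\rangle$, and $\omega=d\vartheta_0$. Let $l:TQ\to\mathbb{R}$ be a smooth Lagrangian with Legendre transformation $\mathscr{L}:TQ\to T^*Q$, $\langle\mathscr{L}(v),w\rangle=\frac{d}{dt}\big|_{t=0}l(v+tw)$, and energy $e(v)=\langle\mathscr{L}(v),v\rangle-l(v)$. Solutions of the Euler–Lagrange equations $\frac{d}{dt}\frac{\partial l}{\partial\dot q}=\frac{\partial l}{\partial q}$ (in all local charts) are understood to be $C^2$ curves in $Q$, and $j^1\gamma(t)=\dot\gamma(t)\in T_{\gamma(t)}Q$ is the first jet extension of a curve $\gamma$. Put $\mathscr{P}=\mathscr{L}(TQ)$ (the primary constraint set), let $\mathscr{D}\subset TQ$ be the set of all vectors $j^1\gamma(0)$ with $\gamma:(-\varepsilon,\varepsilon)\to Q$ a solution of the Euler–Lagrange equations for some $\varepsilon>0$, and put $\mathscr{C}=\mathscr{L}(\mathscr{D})\subset\mathscr{P}$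 (the constraint set). For a subset $S\subset T^*Q$ and $p\in S$ let $T_pS\subset T_p(T^*Q)$ be the space of all tangent vectors $u$ with $df_p(u)=0$ for every smooth function $f$ on $T^*Q$ vanishing on $S$; when $S$ is a submanifold this is its usual tangent space. Let $\omega_{\mathscr{C}}$ be the restriction of $\omega_p$ to $T_p\mathscr{C}$, $p\in\mathscr{C}$. **Theorem.** Assume that $\mathscr{P}$ is a closed (embedded) submanifold of $T^*Q$, that $\mathscr{L}$ is a submersion of $TQ$ onto $\mathscr{P}$ (that is, $d\mathscr{L}_v(T_vTQ)=T_{\mathscr{L}(v)}\mathscr{P}$ for all $v\in TQ$), and that the energy pushes forward to a function $h:\mathscr{P}\to\mathbb{R}$, that is, $e(v)=h(\mathscr{L}(v))$ for all $v\in TQ$. Then: 1. $h$ extends to a smooth function on $T^*Q$. In particular $h_{\mathscr{C}}=h|_{\mathscr{C}}$ is the restriction of a smooth function $H$ on $T^*Q$, and $dh_{\mathscr{C}}$ is defined as the restriction of $dH_p$ to $T_p\mathscr{C}$, $p\in\mathscr{C}$; it does not depend on the choice of the smooth function $H$ on $T^*Q$ with $H|_{\mathscr{C}}=h|_{\mathscr{C}}$.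 2. Let $\gamma$ be a solution of the Euler–Lagrange equations on an open set $J\subset\mathbb{R}$ of times (for instance $J=\mathbb{R}$), and let $c(t)=\mathscr{L}(j^1\gamma(t))$. Then for every $t\in J$ the point $c(t)$ lies in $\mathscr{C}$, the curve $c$ is differentiable at $t$ with $\dot c(t)\in T_{c(t)}\mathscr{C}$, and $$\frac{d}{dt}\mathscr{L}j^1\gamma(t)\;\lrcorner\;\omega_{\mathscr{C}}+dh_{\mathscr{C}}=0,$$ that is, $\omega(\dot c(t),u)+dh_{\mathscr{C}}(u)=0$ for every $u\in T_{c(t)}\mathscr{C}$ and every choice of $H$ in 1. -/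

import Mathlib

open scoped Manifold ContDiff

noncomputable section

/-! ## Subsets of a manifold -/

section Subsets

variable {E' H' M : Type*} [NormedAddCommGroup E'] [NormedSpace ℝ E']
  [TopologicalSpace H'] (I : ModelWithCorners ℝ E' H')
  [TopologicalSpace M] [ChartedSpace H' M]

/-- `S` is an embedded submanifold (without boundary): around each of its points there is a smooth
chart of the ambient manifold in which `S` is a linear slice. -/
def IsEmbeddedSubmanifold (S : Set M) : Prop :=
  ∀ p ∈ S, ∃ φ ∈ IsManifold.maximalAtlas I ∞ M, p ∈ φ.source ∧
    ∃ K : Submodule ℝ E', ∀ x ∈ φ.source, x ∈ S ↔ φ.extend I x - φ.extend I p ∈ K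

/-- The differential `df` of a real-valued function, as a one-form. -/
def differential (f : M → ℝ) (p : M) : TangentSpace I p →L[ℝ] ℝ :=
  mfderiv I 𝓘(ℝ, ℝ) f p

/-- The tangent space at `p` to an arbitrary subset `S` of a manifold: the tangent vectors of the
ambient manifold at `p` that annihilate every smooth function vanishing on `S`. For an embedded
submanifold this is its usual tangent space. -/
def tangentSpaceTo (S : Set M) (p : M) : Submodule ℝ (TangentSpace I p) where
  carrier := {u | ∀ f : M → ℝ, ContMDiff I 𝓘(ℝ, ℝ) ∞ f → (∀ x ∈ S, f x = 0) →
    differential I f p u = 0}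
  zero_mem' := fun f _ _ => map_zero (differential I f p)
  add_mem' := fun {u v} hu hv f hf h0 => by
    rw [map_add, hu f hf h0, hv f hf h0, add_zero]
  smul_mem' := fun c u hu f hf h0 => by
    rw [map_smul, hu f hf h0, smul_zero]

/-- The exterior derivative `dα` of a one-form `α` on a manifold without boundary, at `x` on tangent
vectors `u, v`: read `α` in the preferred chart at `x` and take the exterior derivative there. -/
def extDerivOneForm (α : ∀ x : M, TangentSpace I x →L[ℝ] ℝ) (x : M) (u v : TangentSpace I x) : ℝ :=
  extDeriv
    (fun y : E' => ContinuousAlternatingMap.ofSubsingleton ℝ E' ℝ (0 : Fin 1)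
      ((α ((extChartAt I x).symm y)).comp (mfderiv 𝓘(ℝ, E') I (extChartAt I x).symm y) : E' →L[ℝ] ℝ))
    (extChartAt I x x)
    ![(mfderiv I 𝓘(ℝ, E') (extChartAt I x) x u : E'), (mfderiv I 𝓘(ℝ, E') (extChartAt I x) x v : E')]

end Subsets

/-! ## The cotangent bundle and its symplectic form -/

section Mechanics

variable {E Q : Type*} [NormedAddCommGroup E] [NormedSpace ℝ E]
  [TopologicalSpace Q] [ChartedSpace E Q]

variable (E Q) in
/-- The cotangent bundle `T*Q`, as the bundle of continuous linear functionals on `TQ`. -/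
abbrev CotangentBundle : Type _ :=
  Bundle.TotalSpace (E →L[ℝ] ℝ)
    (fun q : Q => TangentSpace 𝓘(ℝ, E) q →L[ℝ] Bundle.Trivial Q ℝ q)

variable (E) in
/-- The model with corners of the cotangent bundle. -/
abbrev cotangentModel : ModelWithCorners ℝ (E × (E →L[ℝ] ℝ)) (ModelProd E (E →L[ℝ] ℝ)) :=
  𝓘(ℝ, E).prod 𝓘(ℝ, E →L[ℝ] ℝ)

/-- The fundamental (Liouville) one-form `ϑ₀` on `T*Q`: `ϑ₀ p u = ⟨p, dπ u⟩`. -/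
def fundamentalForm [IsManifold 𝓘(ℝ, E) ∞ Q] (p : CotangentBundle E Q) :
    TangentSpace (cotangentModel E) p →L[ℝ] ℝ :=
  (p.2 : TangentSpace 𝓘(ℝ, E) p.1 →L[ℝ] ℝ).comp
    (mfderiv (cotangentModel E) 𝓘(ℝ, E) (fun x : CotangentBundle E Q => x.1) p)

/-- The symplectic form `ω = dϑ₀` on `T*Q`. -/
def symplecticForm [IsManifold 𝓘(ℝ, E) ∞ Q] (p : CotangentBundle E Q)
    (u v : TangentSpace (cotangentModel E) p) : ℝ :=
  extDerivOneForm (cotangentModel E) fundamentalForm p u v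

/-! ## Lagrangian mechanics -/

/-- The Legendre transformation `ℒ : TQ → T*Q` (the fibre derivative of the Lagrangian `l`),
`⟨ℒ v, w⟩ = d/dt l (v + t w)` at `t = 0`. -/
def legendre (l : TangentBundle 𝓘(ℝ, E) Q → ℝ) (v : TangentBundle 𝓘(ℝ, E) Q) :
    CotangentBundle E Q :=
  ⟨v.1, fderiv ℝ (fun w : TangentSpace 𝓘(ℝ, E) v.1 => l ⟨v.1, w⟩) v.2⟩

/-- The energy `e v = ⟨ℒ v, v⟩ - l v`. -/
def energy (l : TangentBundle 𝓘(ℝ, E) Q → ℝ) (v : TangentBundle 𝓘(ℝ, E) Q) : ℝ :=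
  ((legendre l v).2 : TangentSpace 𝓘(ℝ, E) v.1 →L[ℝ] ℝ) v.2 - l v

/-- The first jet extension of a curve in `Q`. -/
def jetOne (γ : ℝ → Q) (t : ℝ) : TangentBundle 𝓘(ℝ, E) Q :=
  ⟨γ t, mfderiv 𝓘(ℝ, ℝ) 𝓘(ℝ, E) γ t (1 : ℝ)⟩

/-- The local expression `ℓ (x, y)` of a Lagrangian in a chart `φ` of `Q`: `x` is the position and
`y` the velocity. -/
def localLagrangian (l : TangentBundle 𝓘(ℝ, E) Q → ℝ) (φ : OpenPartialHomeomorph Q E) (x y : E) :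
    ℝ :=
  l ⟨φ.symm x, mfderiv 𝓘(ℝ, E) 𝓘(ℝ, E) φ.symm x y⟩

/-- `γ` is a (`C²`) solution of the Euler-Lagrange equations `d/dt (∂ℓ/∂y) = ∂ℓ/∂x` on the open set
`J` of times, in every chart of the atlas of `Q`. -/
def IsEulerLagrangeSolutionOn (l : TangentBundle 𝓘(ℝ, E) Q → ℝ) (γ : ℝ → Q) (J : Set ℝ) : Prop :=
  ContMDiffOn 𝓘(ℝ, ℝ) 𝓘(ℝ, E) 2 γ J ∧
    ∀ t ∈ J, ∀ φ ∈ atlas E Q, γ t ∈ φ.source →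
      HasDerivAt
        (fun s : ℝ =>
          fderiv ℝ (fun y : E => localLagrangian l φ (φ (γ s)) y) (deriv (fun r => φ (γ r)) s))
        (fderiv ℝ (fun x : E => localLagrangian l φ x (deriv (fun r => φ (γ r)) t)) (φ (γ t))) t

/-- The primary constraint set `𝒫 = ℒ(TQ)`. -/
def primaryConstraintSet (l : TangentBundle 𝓘(ℝ, E) Q → ℝ) : Set (CotangentBundle E Q) :=
  Set.range (legendre l)

/-- The initial data constraint `𝒟`: all initial velocities of solutions of the Euler-Lagrange
equations defined on some interval `(-ε, ε)`. -/
def initialDataConstraint (l : TangentBundle 𝓘(ℝ, E) Q → ℝ) : Set (TangentBundle 𝓘(ℝ, E) Q) :=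
  {v | ∃ ε > (0 : ℝ), ∃ γ : ℝ → Q,
    IsEulerLagrangeSolutionOn l γ (Set.Ioo (-ε) ε) ∧ jetOne γ 0 = v}

/-- The constraint set `𝒞 = ℒ(𝒟)`. -/
def constraintSet (l : TangentBundle 𝓘(ℝ, E) Q → ℝ) : Set (CotangentBundle E Q) :=
  legendre l '' initialDataConstraint l

/-- The Legendre transformation is a submersion of `TQ` onto (the submanifold) `𝒫`: at each `v` its
differential maps `T_v TQ` onto the tangent space of `𝒫` at `ℒ v`. -/
def LegendreIsSubmersion [IsManifold 𝓘(ℝ, E) ∞ Q] (l : TangentBundle 𝓘(ℝ, E) Q → ℝ) : Prop :=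
  ∀ v : TangentBundle 𝓘(ℝ, E) Q,
    Set.range (mfderiv 𝓘(ℝ, E).tangent (cotangentModel E) (legendre l) v) =
      (tangentSpaceTo (cotangentModel E) (primaryConstraintSet l) (legendre l v) :
        Set (TangentSpace (cotangentModel E) (legendre l v)))

end Mechanics

end

noncomputable section

open scoped Topology
open Bundle Set

/-! ## Charts of the tangent and cotangent bundles -/

section BundleCharts

variable {E Q : Type*} [NormedAddCommGroup E] [NormedSpace ℝ E]
  [TopologicalSpace Q] [ChartedSpace E Q] [IsManifold 𝓘(ℝ, E) ∞ Q]

/-! Work in bundle coordinates `(x, y)` on `TQ` and `(x, ξ)` on `T*Q`, with `F` the local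
Lagrangian. There `ℒ = (x, F_y)`, `e = F_y y - F`, and `ω((a, α), (b, β)) = α b - β a`
(`symplecticForm_apply`). Along a solution the Euler-Lagrange equation says that `c = ℒ ∘ j¹γ` has
velocity `(y, F_x)`. For a vector `w = (a, b)` at the jet write `dℒ w = (a, β)`. The terms `F_y b`
cancel in `de(w)`, leaving `β y - F_x a`, while `ω(ċ, dℒ w) = F_x a - β y`. The sum vanishes
(`fderiv_localEnergy_hamilton`), with no condition on the fibre Hessian.

This settles all vectors in the image of `dℒ`, which is `T𝒫` by the submersion hypothesis. Functions
vanishing on `𝒫` vanish on `𝒞`, so `T𝒞 ⊆ T𝒫` and every `u ∈ T𝒞` lifts to the jet. If `H₀` extends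
`h`, then `dH₀ ∘ dℒ = de`; any other admissible `H` differs from `H₀` by a function vanishing on
`𝒞`, whose differential kills `u`.

The extension `H₀` exists because a submersion onto a slice has smooth local sections: pull `e` back
along one, after projecting an ambient neighbourhood to the slice. Constancy of `e` on fibres makes
the local extensions agree on `𝒫`, and a partition of unity glues them
(`IsEmbeddedSubmanifold.exists_contMDiff_extension`). -/

theorem tangent_extChartAt_target (v : TangentBundle 𝓘(ℝ, E) Q) :
    (extChartAt 𝓘(ℝ, E).tangent v).target = (chartAt E v.1).target ×ˢ univ := by
  rw [FiberBundle.extChartAt_target]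
  simpa using (chartAt E v.1).target_subset_preimage_source

theorem tangent_extChartAt_symm_chart (v : TangentBundle 𝓘(ℝ, E) Q) {q : Q} (y : E)
    (hq : q ∈ (chartAt E v.1).source) :
    (extChartAt 𝓘(ℝ, E).tangent v).symm (chartAt E v.1 q, y) =
      ⟨q, mfderiv 𝓘(ℝ, E) 𝓘(ℝ, E) (chartAt E v.1).symm (chartAt E v.1 q) y⟩ := by
  have key := TangentBundle.symmL_trivializationAt (I := 𝓘(ℝ, E)) (𝕜 := ℝ) hq
  have h1 := Trivialization.mk_symm (trivializationAt E (TangentSpace 𝓘(ℝ, E)) v.1) hq y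
  rw [FiberBundle.extChartAt]
  simp only [extChartAt, PartialEquiv.coe_trans_symm, Function.comp_apply, PartialEquiv.prod_symm,
    PartialEquiv.prod_coe]
  simp only [mfld_simps, mfderivWithin_univ, (chartAt E v.1).left_inv hq] at key ⊢
  rw [← h1, ← Trivialization.symmL_apply (R := ℝ) _ hq]
  exact congrArg (fun A : E →L[ℝ] E => (⟨q, A y⟩ : TangentBundle 𝓘(ℝ, E) Q)) key

theorem tangent_extChartAt_symm_apply (v : TangentBundle 𝓘(ℝ, E) Q) {x : E} (y : E)
    (hx : x ∈ (chartAt E v.1).target) :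
    (extChartAt 𝓘(ℝ, E).tangent v).symm (x, y) =
      ⟨(chartAt E v.1).symm x, mfderiv 𝓘(ℝ, E) 𝓘(ℝ, E) (chartAt E v.1).symm x y⟩ := by
  have := tangent_extChartAt_symm_chart v y ((chartAt E v.1).map_target hx)
  rwa [(chartAt E v.1).right_inv hx] at this

theorem cotangent_extChartAt_target (p : CotangentBundle E Q) :
    (extChartAt (cotangentModel E) p).target = (chartAt E p.1).target ×ˢ univ := by
  rw [FiberBundle.extChartAt_target]
  simpa using (chartAt E p.1).target_subset_preimage_source

theorem cotangent_extChartAt_source (p : CotangentBundle E Q) :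
    (extChartAt (cotangentModel E) p).source = (fun q => q.1) ⁻¹' (chartAt E p.1).source := by
  rw [FiberBundle.extChartAt]
  ext q
  have : (trivializationAt (E →L[ℝ] ℝ)
    (fun x => TangentSpace 𝓘(ℝ, E) x →L[ℝ] Trivial Q ℝ x) p.1 q).1 = q.1 := rfl
  simp [Trivialization.source_eq, this]

/-- Covectors are precomposed with the same Jacobian that carries velocities from the chart to `TQ`,
so coordinates preserve the pairing. -/
theorem cotangent_extChartAt_apply (p : CotangentBundle E Q) {q : CotangentBundle E Q}
    (hq : q.1 ∈ (chartAt E p.1).source) :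
    extChartAt (cotangentModel E) p q = (chartAt E p.1 q.1, (show E →L[ℝ] ℝ from
      (q.2 : E →L[ℝ] ℝ).comp
        (mfderiv 𝓘(ℝ, E) 𝓘(ℝ, E) (chartAt E p.1).symm (chartAt E p.1 q.1) : E →L[ℝ] E))) := by
  rw [FiberBundle.extChartAt]
  have := TangentBundle.symmL_trivializationAt (I := 𝓘(ℝ, E)) (𝕜 := ℝ) hq
  refine Prod.ext rfl ?_
  simp [hom_trivializationAt_apply, ContinuousLinearMap.inCoordinates, this]

theorem cotangent_extChartAt_symm_proj (p : CotangentBundle E Q) {z : E × (E →L[ℝ] ℝ)}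
    (hz : z.1 ∈ (chartAt E p.1).target) :
    ((extChartAt (cotangentModel E) p).symm z).1 = (chartAt E p.1).symm z.1 := by
  have hs := (chartAt E p.1).map_target hz
  rw [FiberBundle.extChartAt]
  exact (trivializationAt (E →L[ℝ] ℝ)
    (fun x => TangentSpace 𝓘(ℝ, E) x →L[ℝ] Trivial Q ℝ x) p.1).proj_symm_apply'
    (b := (chartAt E p.1).symm z.1) (by simpa using hs)

instance CotangentBundle.t2Space [T2Space Q] :
    T2Space (CotangentBundle E Q) := by
  refine ⟨fun p q hpq => ?_⟩
  by_cases h : p.1 = q.1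
  · have hq : q ∈ (extChartAt (cotangentModel E) p).source := by
      rw [cotangent_extChartAt_source]; simp [← h]
    have hp := mem_extChartAt_source (I := cotangentModel E) p
    have := t2_separation ((extChartAt (cotangentModel E) p).injOn.ne hp hq hpq)
    obtain ⟨u, v, hu, hv, h1, h2, h3⟩ := this
    have hopen {u : Set (E × (E →L[ℝ] ℝ))} (hu : IsOpen u) :=
      (continuousOn_extChartAt (I := cotangentModel E) p).isOpen_inter_preimage
        (isOpen_extChartAt_source p) hu
    exact ⟨_, _, hopen hu, hopen hv, ⟨hp, h1⟩, ⟨hq, h2⟩,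
      (h3.preimage _).mono inter_subset_right inter_subset_right⟩
  · obtain ⟨u, v, hu, hv, h1, h2, h3⟩ := t2_separation h
    have hc : Continuous (fun q : CotangentBundle E Q => q.1) := FiberBundle.continuous_proj _ _
    exact ⟨_, _, hu.preimage hc, hv.preimage hc, h1, h2, h3.preimage _⟩

/-- Together with the Hausdorff property, this is what the partition of unity requires. -/
instance CotangentBundle.sigmaCompactSpace [FiniteDimensional ℝ E] [SecondCountableTopology Q] :
    SigmaCompactSpace (CotangentBundle E Q) := by
  have : ProperSpace E := FiniteDimensional.proper ℝ E
  have : ProperSpace (E →L[ℝ] ℝ) := FiniteDimensional.proper ℝ _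
  have : SecondCountableTopology (ModelProd E (E →L[ℝ] ℝ)) :=
    inferInstanceAs (SecondCountableTopology (E × (E →L[ℝ] ℝ)))
  have : LocallyCompactSpace (CotangentBundle E Q) :=
    Manifold.locallyCompact_of_finiteDimensional (cotangentModel E)
  have : SecondCountableTopology (CotangentBundle E Q) := by
    obtain ⟨s, hs, hu⟩ := TopologicalSpace.countable_cover_nhds (chart_source_mem_nhds E (M := Q))
    refine ChartedSpace.secondCountable_of_countable_cover (ModelProd E (E →L[ℝ] ℝ))
      -- A chart domain of `T*Q` is the full preimage of one in `Q`, so any covector over `q` serves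
      -- as a centre; zero is chosen.
      (s := (fun q => (⟨q, 0⟩ : CotangentBundle E Q)) '' s) ?_ (hs.image _)
    refine eq_univ_of_forall fun p => ?_
    obtain ⟨q, hq, hpq⟩ := mem_iUnion₂.1 (hu ▸ mem_univ p.1)
    refine mem_iUnion₂.2 ⟨_, mem_image_of_mem _ hq, ?_⟩
    rw [← extChartAt_source (cotangentModel E), cotangent_extChartAt_source]
    exact hpq
  infer_instance

end BundleCharts

/-- A one-form with linear coefficients has constant derivative, so its exterior derivative is the
antisymmetrization of `B`. This fixes the sign of `ω`. -/
theorem extDeriv_ofSubsingleton_clm {V : Type*} [NormedAddCommGroup V] [NormedSpace ℝ V]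
    (B : V →L[ℝ] V →L[ℝ] ℝ) (z u v : V) :
    extDeriv (fun z => ContinuousAlternatingMap.ofSubsingleton ℝ V ℝ (0 : Fin 1) (B z)) z ![u, v]
      = B u v - B v u := by
  have hd : DifferentiableAt ℝ
      (fun z => ContinuousAlternatingMap.ofSubsingleton ℝ V ℝ (0 : Fin 1) (B z)) z :=
    (ContinuousAlternatingMap.ofSubsingletonLIE (𝕜 := ℝ) (E := V) (F := ℝ)
      (i := (0 : Fin 1))).differentiable.differentiableAt.comp z B.differentiableAt
  have hf (w : V) : fderiv ℝ (fun z => B z w) z = B.flip w :=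
    (B.flip w).fderiv
  rw [extDeriv_apply hd]
  simp [Fin.sum_univ_two, Fin.removeNth, hf]
  ring

/-! ## The symplectic form in bundle coordinates -/

section SymplecticForm

variable {E Q : Type*} [NormedAddCommGroup E] [NormedSpace ℝ E]
  [TopologicalSpace Q] [ChartedSpace E Q] [IsManifold 𝓘(ℝ, E) ∞ Q]

/-- In coordinates the bundle projection is `Prod.fst` followed by the inverse chart; the Jacobian
this produces is absorbed by the covector coordinate. -/
theorem fundamentalForm_comp_mfderiv_extChartAt_symm (p : CotangentBundle E Q)
    {z : E × (E →L[ℝ] ℝ)} (hz : z ∈ (extChartAt (cotangentModel E) p).target) :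
    ((fundamentalForm ((extChartAt (cotangentModel E) p).symm z)).comp
      (mfderiv 𝓘(ℝ, E × (E →L[ℝ] ℝ)) (cotangentModel E) (extChartAt (cotangentModel E) p).symm z) :
        E × (E →L[ℝ] ℝ) →L[ℝ] ℝ) = z.2.comp (ContinuousLinearMap.fst ℝ E (E →L[ℝ] ℝ)) := by
  have hz1 : z.1 ∈ (chartAt E p.1).target := by
    rw [cotangent_extChartAt_target] at hz; exact hz.1
  have hproj := cotangent_extChartAt_symm_proj p hz1
  have hmem : ((extChartAt (cotangentModel E) p).symm z).1 ∈ (chartAt E p.1).source := by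
    rw [hproj]; exact (chartAt E p.1).map_target hz1
  have h2 := cotangent_extChartAt_apply p hmem
  rw [(extChartAt (cotangentModel E) p).right_inv hz, hproj, (chartAt E p.1).right_inv hz1] at h2
  have hev : (fun x : CotangentBundle E Q => x.1) ∘ (extChartAt (cotangentModel E) p).symm
      =ᶠ[𝓝 z] (chartAt E p.1).symm ∘ Prod.fst := by
    filter_upwards [(isOpen_extChartAt_target p).mem_nhds hz] with z' hz'
    rw [cotangent_extChartAt_target] at hz'
    exact cotangent_extChartAt_symm_proj p hz'.1
  have hd1 : MDifferentiableAt (cotangentModel E) 𝓘(ℝ, E) (fun x : CotangentBundle E Q => x.1)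
      ((extChartAt (cotangentModel E) p).symm z) :=
    (contMDiffAt_proj (n := 1) _).mdifferentiableAt one_ne_zero
  have hd2 : MDifferentiableAt 𝓘(ℝ, E × (E →L[ℝ] ℝ)) (cotangentModel E)
      (extChartAt (cotangentModel E) p).symm z :=
    ((contMDiffOn_extChartAt_symm (n := ∞) p).contMDiffAt
      ((isOpen_extChartAt_target p).mem_nhds hz)).mdifferentiableAt (by simp)
  have hd3 : MDifferentiableAt 𝓘(ℝ, E) 𝓘(ℝ, E) (chartAt E p.1).symm z.1 :=
    mdifferentiableAt_atlas_symm (chart_mem_atlas E p.1) hz1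
  have hd4 : MDifferentiableAt 𝓘(ℝ, E × (E →L[ℝ] ℝ)) 𝓘(ℝ, E) (Prod.fst : E × (E →L[ℝ] ℝ) → E) z :=
    differentiableAt_fst.mdifferentiableAt
  have hcomp := mfderiv_comp z hd1 hd2
  rw [hev.mfderiv_eq, mfderiv_comp z hd3 hd4, mfderiv_eq_fderiv, fderiv_fst] at hcomp
  set q := (extChartAt (cotangentModel E) p).symm z
  refine ContinuousLinearMap.ext fun w => ?_
  exact (congrArg (q.2 : E →L[ℝ] ℝ) (DFunLike.congr_fun hcomp.symm w)).trans
    (DFunLike.congr_fun (congrArg Prod.snd h2).symm w.1)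

variable (E) in
/-- The Liouville one-form `(x, ξ) ↦ ((a, b) ↦ ξ a)` of the linear cotangent bundle `E × E*`. -/
def liouvilleBilin : (E × (E →L[ℝ] ℝ)) →L[ℝ] (E × (E →L[ℝ] ℝ)) →L[ℝ] ℝ :=
  ((ContinuousLinearMap.compL ℝ (E × (E →L[ℝ] ℝ)) E ℝ).flip
    (ContinuousLinearMap.fst ℝ E (E →L[ℝ] ℝ))).comp (ContinuousLinearMap.snd ℝ E (E →L[ℝ] ℝ))

theorem symplecticForm_apply (p : CotangentBundle E Q) (u v : TangentSpace (cotangentModel E) p)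
    (u' v' : E × (E →L[ℝ] ℝ))
    (hu : mfderiv (cotangentModel E) 𝓘(ℝ, E × (E →L[ℝ] ℝ)) (extChartAt (cotangentModel E) p) p u
      = u')
    (hv : mfderiv (cotangentModel E) 𝓘(ℝ, E × (E →L[ℝ] ℝ)) (extChartAt (cotangentModel E) p) p v
      = v') :
    symplecticForm p u v = u'.2 v'.1 - v'.2 u'.1 := by
  rw [symplecticForm, extDerivOneForm, hu, hv]
  have hev : (fun z : E × (E →L[ℝ] ℝ) =>
      ContinuousAlternatingMap.ofSubsingleton ℝ (E × (E →L[ℝ] ℝ)) ℝ (0 : Fin 1)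
      ((fundamentalForm ((extChartAt (cotangentModel E) p).symm z)).comp
        (mfderiv 𝓘(ℝ, E × (E →L[ℝ] ℝ)) (cotangentModel E)
          (extChartAt (cotangentModel E) p).symm z) : E × (E →L[ℝ] ℝ) →L[ℝ] ℝ))
      =ᶠ[𝓝 (extChartAt (cotangentModel E) p p)] fun z =>
        ContinuousAlternatingMap.ofSubsingleton ℝ (E × (E →L[ℝ] ℝ)) ℝ (0 : Fin 1)
          (liouvilleBilin E z) := by
    filter_upwards [extChartAt_target_mem_nhds p] with z hz
    rw [fundamentalForm_comp_mfderiv_extChartAt_symm p hz]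
    rfl
  exact hev.extDeriv_eq ▸ extDeriv_ofSubsingleton_clm (liouvilleBilin E) _ u' v'

end SymplecticForm

/-! ## The Legendre transformation and the energy in bundle coordinates -/

section LocalExpressions

variable {E Q : Type*} [NormedAddCommGroup E] [NormedSpace ℝ E]
  [TopologicalSpace Q] [ChartedSpace E Q] [IsManifold 𝓘(ℝ, E) ∞ Q]
  {l : TangentBundle 𝓘(ℝ, E) Q → ℝ}

/-- The fibre derivative `(x, y) ↦ (x, ∂F/∂y)` of a function on `E × E`. -/
def fibreDeriv (F : E × E → ℝ) (z : E × E) : E × (E →L[ℝ] ℝ) :=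
  (z.1, (fderiv ℝ F z).comp (ContinuousLinearMap.inr ℝ E E))

/-- The energy `∂F/∂y · y - F` of a function on `E × E`. -/
def localEnergy (F : E × E → ℝ) (z : E × E) : ℝ :=
  (fibreDeriv F z).2 z.2 - F z

theorem ContDiffOn.fibreDeriv {F : E × E → ℝ} {U : Set (E × E)} (hF : ContDiffOn ℝ ∞ F U)
    (hU : IsOpen U) : ContDiffOn ℝ ∞ (fibreDeriv F) U :=
  contDiffOn_fst.prodMk ((hF.fderiv_of_isOpen hU (by simp)).clm_comp contDiffOn_const)

theorem ContDiffOn.localEnergy {F : E × E → ℝ} {U : Set (E × E)} (hF : ContDiffOn ℝ ∞ F U)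
    (hU : IsOpen U) : ContDiffOn ℝ ∞ (localEnergy F) U :=
  ((hF.fibreDeriv hU).snd.clm_apply contDiffOn_snd).sub hF

theorem fderiv_prodMk_left {F : E × E → ℝ} {x y : E} (hF : DifferentiableAt ℝ F (x, y)) :
    fderiv ℝ (fun y => F (x, y)) y = (fderiv ℝ F (x, y)).comp (ContinuousLinearMap.inr ℝ E E) :=
  (hF.hasFDerivAt.comp y (hasFDerivAt_prodMk_right x y)).fderiv

theorem fderiv_prodMk_right {F : E × E → ℝ} {x y : E} (hF : DifferentiableAt ℝ F (x, y)) :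
    fderiv ℝ (fun x => F (x, y)) x = (fderiv ℝ F (x, y)).comp (ContinuousLinearMap.inl ℝ E E) :=
  (hF.hasFDerivAt.comp x (hasFDerivAt_prodMk_left x y)).fderiv

/-- The local expression of the Lagrangian in the chart at `q`, as a function on `E × E`. -/
def lagrangianAt (l : TangentBundle 𝓘(ℝ, E) Q → ℝ) (q : Q) (z : E × E) : ℝ :=
  localLagrangian l (chartAt E q) z.1 z.2

theorem lagrangianAt_eqOn (v : TangentBundle 𝓘(ℝ, E) Q) :
    EqOn (lagrangianAt l v.1) (l ∘ (extChartAt 𝓘(ℝ, E).tangent v).symm)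
      (extChartAt 𝓘(ℝ, E).tangent v).target := by
  intro z hz
  rw [tangent_extChartAt_target] at hz
  exact (congrArg l (tangent_extChartAt_symm_apply v z.2 hz.1)).symm

theorem contDiffOn_lagrangianAt (hl : ContMDiff 𝓘(ℝ, E).tangent 𝓘(ℝ, ℝ) ∞ l)
    (v : TangentBundle 𝓘(ℝ, E) Q) :
    ContDiffOn ℝ ∞ (lagrangianAt l v.1) (extChartAt 𝓘(ℝ, E).tangent v).target :=
  (contMDiffOn_iff_contDiffOn.1
    (hl.comp_contMDiffOn (contMDiffOn_extChartAt_symm v))).congr (lagrangianAt_eqOn v)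

theorem differentiableAt_lagrangianAt (hl : ContMDiff 𝓘(ℝ, E).tangent 𝓘(ℝ, ℝ) ∞ l)
    (v : TangentBundle 𝓘(ℝ, E) Q) {z : E × E}
    (hz : z ∈ (extChartAt 𝓘(ℝ, E).tangent v).target) :
    DifferentiableAt ℝ (lagrangianAt l v.1) z :=
  ((contDiffOn_lagrangianAt hl v).contDiffAt
    ((isOpen_extChartAt_target v).mem_nhds hz)).differentiableAt (by simp)

/-- The chart acts on velocities by a linear isomorphism, so the chain rule holds here without
differentiability of `l`. -/
theorem fderiv_localLagrangian_velocity (l : TangentBundle 𝓘(ℝ, E) Q → ℝ) (q : Q) {x : E} (y : E)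
    (hx : x ∈ (chartAt E q).target) :
    fderiv ℝ (localLagrangian l (chartAt E q) x) y =
      ((fderiv ℝ (fun w : TangentSpace 𝓘(ℝ, E) ((chartAt E q).symm x) =>
          l ⟨(chartAt E q).symm x, w⟩)
          (mfderiv 𝓘(ℝ, E) 𝓘(ℝ, E) (chartAt E q).symm x y) : E →L[ℝ] ℝ)).comp
        (mfderiv 𝓘(ℝ, E) 𝓘(ℝ, E) (chartAt E q).symm x : E →L[ℝ] E) := by
  have hinv := isInvertible_mfderivWithin_extChartAt_symm (I := 𝓘(ℝ, E)) (x := q) (y := x)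
    (by simpa using hx)
  simp only [mfld_simps, mfderivWithin_univ] at hinv
  obtain ⟨A, hA⟩ : ∃ A : E ≃L[ℝ] E,
    (A : E →L[ℝ] E) = mfderiv 𝓘(ℝ, E) 𝓘(ℝ, E) (chartAt E q).symm x := hinv
  rw [← hA]
  refine Eq.trans ?_ (A.comp_right_fderiv (f := fun w : E => l ⟨(chartAt E q).symm x, w⟩) (x := y))
  congr 1
  ext w
  exact congrArg (fun B : E →L[ℝ] E => l ⟨(chartAt E q).symm x, B w⟩) hA.symm

/-- The Jacobian from the chain rule in the velocity is exactly the one in the covector coordinate.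
-/
theorem extChartAt_legendre (hl : ContMDiff 𝓘(ℝ, E).tangent 𝓘(ℝ, ℝ) ∞ l)
    (v : TangentBundle 𝓘(ℝ, E) Q) {z : E × E}
    (hz : z ∈ (extChartAt 𝓘(ℝ, E).tangent v).target) :
    extChartAt (cotangentModel E) (legendre l v)
      (legendre l ((extChartAt 𝓘(ℝ, E).tangent v).symm z)) =
      fibreDeriv (lagrangianAt l v.1) z := by
  have hz1 := hz
  rw [tangent_extChartAt_target] at hz1
  have hx := (chartAt E v.1).map_target hz1.1
  have h2 := fderiv_prodMk_left (differentiableAt_lagrangianAt hl v hz)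
  have h3 := fderiv_localLagrangian_velocity l v.1 z.2 hz1.1
  rw [tangent_extChartAt_symm_apply v z.2 hz1.1, cotangent_extChartAt_apply]
  swap
  · exact hx
  refine Prod.ext ((chartAt E v.1).right_inv hz1.1) ?_
  have h4 : chartAt E v.1 ((chartAt E v.1).symm z.1) = z.1 := (chartAt E v.1).right_inv hz1.1
  refine Eq.trans ?_ (h3.symm.trans h2)
  simp only [legendre]
  rw [h4]
  rfl

theorem energy_extChartAt_symm (hl : ContMDiff 𝓘(ℝ, E).tangent 𝓘(ℝ, ℝ) ∞ l)
    (v : TangentBundle 𝓘(ℝ, E) Q) {z : E × E}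
    (hz : z ∈ (extChartAt 𝓘(ℝ, E).tangent v).target) :
    energy l ((extChartAt 𝓘(ℝ, E).tangent v).symm z) = localEnergy (lagrangianAt l v.1) z := by
  have hz1 := hz
  rw [tangent_extChartAt_target] at hz1
  have h2 := fderiv_prodMk_left (differentiableAt_lagrangianAt hl v hz)
  have h3 := fderiv_localLagrangian_velocity l v.1 z.2 hz1.1
  rw [tangent_extChartAt_symm_apply v z.2 hz1.1]
  exact congrArg (fun A : E →L[ℝ] ℝ => A z.2 - lagrangianAt l v.1 z) (h3.symm.trans h2)

theorem contMDiffAt_of_comp_extChartAt_symm {E' H' M E'' H'' N : Type*}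
    [NormedAddCommGroup E'] [NormedSpace ℝ E'] [TopologicalSpace H'] {I : ModelWithCorners ℝ E' H'}
    [TopologicalSpace M] [ChartedSpace H' M] [IsManifold I ∞ M] [I.Boundaryless]
    [NormedAddCommGroup E''] [NormedSpace ℝ E''] [TopologicalSpace H'']
    {J : ModelWithCorners ℝ E'' H''} [TopologicalSpace N] [ChartedSpace H'' N]
    {f : M → N} {x : M}
    (hf : ContMDiffAt 𝓘(ℝ, E') J ∞ (f ∘ (extChartAt I x).symm) (extChartAt I x x)) :
    ContMDiffAt I J ∞ f x := by
  refine (hf.comp x (contMDiffAt_extChartAt (x := x))).congr_of_eventuallyEq ?_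
  filter_upwards [extChartAt_source_mem_nhds (I := I) x] with y hy
  simp only [Function.comp_apply, (extChartAt I x).left_inv hy]

theorem contMDiff_energy (hl : ContMDiff 𝓘(ℝ, E).tangent 𝓘(ℝ, ℝ) ∞ l) :
    ContMDiff 𝓘(ℝ, E).tangent 𝓘(ℝ, ℝ) ∞ (energy l) := fun v => by
  refine contMDiffAt_of_comp_extChartAt_symm (ContDiffAt.contMDiffAt ?_)
  have hU := isOpen_extChartAt_target (I := 𝓘(ℝ, E).tangent) v
  exact (((contDiffOn_lagrangianAt hl v).localEnergy hU).congr
    fun z hz => energy_extChartAt_symm hl v hz).contDiffAt (extChartAt_target_mem_nhds v)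

theorem contMDiff_legendre (hl : ContMDiff 𝓘(ℝ, E).tangent 𝓘(ℝ, ℝ) ∞ l) :
    ContMDiff 𝓘(ℝ, E).tangent (cotangentModel E) ∞ (legendre l) := fun v => by
  refine contMDiffAt_of_comp_extChartAt_symm ?_
  have hU := isOpen_extChartAt_target (I := 𝓘(ℝ, E).tangent) v
  have h1 : ContMDiffAt 𝓘(ℝ, E × E) 𝓘(ℝ, E × (E →L[ℝ] ℝ)) ∞ (fibreDeriv (lagrangianAt l v.1))
      (extChartAt 𝓘(ℝ, E).tangent v v) :=
    (((contDiffOn_lagrangianAt hl v).fibreDeriv hU).contDiffAt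
      (extChartAt_target_mem_nhds v)).contMDiffAt
  have h0 : fibreDeriv (lagrangianAt l v.1) (extChartAt 𝓘(ℝ, E).tangent v v) =
      extChartAt (cotangentModel E) (legendre l v) (legendre l v) := by
    rw [← extChartAt_legendre hl v (mem_extChartAt_target v), extChartAt_to_inv]
  have h2 : ContMDiffAt 𝓘(ℝ, E × (E →L[ℝ] ℝ)) (cotangentModel E) ∞
      (extChartAt (cotangentModel E) (legendre l v)).symm
      (fibreDeriv (lagrangianAt l v.1) (extChartAt 𝓘(ℝ, E).tangent v v)) := by
    rw [h0]
    exact (contMDiffOn_extChartAt_symm (legendre l v)).contMDiffAt (extChartAt_target_mem_nhds _)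
  refine (h2.comp _ h1).congr_of_eventuallyEq ?_
  filter_upwards [extChartAt_target_mem_nhds v] with z hz
  rw [Function.comp_apply, Function.comp_apply, ← extChartAt_legendre hl v hz,
    PartialEquiv.left_inv]
  rw [cotangent_extChartAt_source, mem_preimage]
  rw [tangent_extChartAt_target] at hz
  have := tangent_extChartAt_symm_apply v z.2 hz.1
  rw [this]
  exact (chartAt E v.1).map_target hz.1

end LocalExpressions

/-! ## Functions on the image of a submersion onto an embedded submanifold -/

/-- The inverse function theorem with a single neighbourhood on which the inverse is `C^∞`;
smoothness at one point would only give a neighbourhood for each finite order. -/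
theorem ContDiffOn.exists_contDiffOn_localInverse {V W : Type*} [NormedAddCommGroup V]
    [NormedSpace ℝ V] [CompleteSpace V] [NormedAddCommGroup W] [NormedSpace ℝ W] {G : V → W}
    {O : Set V} (hO : IsOpen O) (hG : ContDiffOn ℝ ∞ G O) {a : V} (ha : a ∈ O) {A : V ≃L[ℝ] W}
    (hA : HasFDerivAt G (A : V →L[ℝ] W) a) :
    ∃ (g : W → V) (U : Set W), IsOpen U ∧ G a ∈ U ∧ ContDiffOn ℝ ∞ g U ∧ MapsTo g U O ∧
      ∀ w ∈ U, G (g w) = w := by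
  have hGa := hG.contDiffAt (hO.mem_nhds ha)
  set P := hGa.toOpenPartialHomeomorph G hA (by simp) with hP
  have haP : a ∈ P.source := hGa.mem_toOpenPartialHomeomorph_source hA (by simp)
  have hPcoe : (P : V → W) = G := rfl
  -- Invertibility of the derivative is an open condition, so the inverse is smooth at every point
  -- whose preimage lies in `O'`.
  set O' := O ∩ fderiv ℝ G ⁻¹' range ((↑) : (V ≃L[ℝ] W) → V →L[ℝ] W) with hO'
  have hO'_open : IsOpen O' :=
    (hG.continuousOn_fderiv_of_isOpen hO (by simp)).isOpen_inter_preimage hO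
      ContinuousLinearEquiv.isOpen
  have haO' : a ∈ O' := ⟨ha, A, hA.fderiv.symm⟩
  refine ⟨P.symm, P.target ∩ P.symm ⁻¹' O', P.isOpen_inter_preimage_symm hO'_open,
    ⟨P.map_source haP, ?_⟩, fun w hw => ?_, fun w hw => hw.2.1, fun w hw => P.right_inv hw.1⟩
  · rw [mem_preimage, ← hPcoe, P.left_inv haP]
    exact haO'
  · obtain ⟨B, hB⟩ := hw.2.2
    have hGw := hG.contDiffAt (hO.mem_nhds hw.2.1)
    refine (P.contDiffAt_symm (f₀' := B) hw.1 ?_ hGw).contDiffWithinAt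
    rw [hB]
    exact (hGw.differentiableAt (by simp)).hasFDerivAt

/-- Restrict `F` to an affine copy of `K` through `z`, chosen so that the restriction, read in `K`,
has derivative the identity, and invert it. The projection `ρ` onto `K` makes the section smooth on
an open set of `W`, not just on the slice. -/
theorem ContDiffOn.exists_contDiffOn_section {V W : Type*} [NormedAddCommGroup V]
    [NormedSpace ℝ V] [FiniteDimensional ℝ V] [NormedAddCommGroup W] [NormedSpace ℝ W]
    [FiniteDimensional ℝ W] {F : V → W} {O : Set V} (hO : IsOpen O) (hF : ContDiffOn ℝ ∞ F O)
    {z : V} (hz : z ∈ O) {K : Submodule ℝ W} (hK : ∀ z' ∈ O, F z' - F z ∈ K)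
    (hr : ∀ k ∈ K, ∃ u, fderiv ℝ F z u = k) :
    ∃ (σ : W → V) (U : Set W), IsOpen U ∧ F z ∈ U ∧ ContDiffOn ℝ ∞ σ U ∧ MapsTo σ U O ∧
      ∀ w ∈ U, w - F z ∈ K → F (σ w) = w := by
  obtain ⟨ρ, hρ⟩ := Submodule.ClosedComplemented.of_finiteDimensional K
  -- A linear right inverse of the derivative over `K`, available because vector spaces are
  -- projective.
  obtain ⟨R₀, hR₀⟩ : ∃ R : K →ₗ[ℝ] V, ∀ k : K, fderiv ℝ F z (R k) = k := by
    obtain ⟨R, hR⟩ := Module.projective_lifting_property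
      (LinearMap.rangeRestrict (fderiv ℝ F z : V →ₗ[ℝ] W))
      (Submodule.inclusion fun k hk => hr k hk) (LinearMap.surjective_rangeRestrict _)
    exact ⟨R, fun k => congrArg Subtype.val (LinearMap.congr_fun hR k)⟩
  set R : K →L[ℝ] V := LinearMap.toContinuousLinearMap R₀ with hRdef
  have hR : ∀ k : K, fderiv ℝ F z (R k) = k := hR₀
  set τ : K → V := fun k => z + R k with hτ
  have hτ_smooth : ContDiff ℝ ∞ τ := contDiff_const.add R.contDiff
  set O' : Set K := τ ⁻¹' O with hO'
  have hO'_open : IsOpen O' := hO.preimage hτ_smooth.continuous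
  have hτ0 : τ 0 = z := by simp [hτ]
  have h0 : (0 : K) ∈ O' := by rw [hO', mem_preimage, hτ0]; exact hz
  set G : K → K := fun k => ρ (F (τ k) - F z) with hGdef
  have hG : ContDiffOn ℝ ∞ G O' :=
    ρ.contDiff.comp_contDiffOn ((hF.comp hτ_smooth.contDiffOn fun k hk => hk).sub contDiffOn_const)
  have hG0 : G 0 = 0 := by simp [hGdef, hτ0]
  have hGd : HasFDerivAt G ((ContinuousLinearEquiv.refl ℝ K : K ≃L[ℝ] K) : K →L[ℝ] K) 0 := by
    have h1 : HasFDerivAt τ R 0 := R.hasFDerivAt.const_add z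
    have h2 : HasFDerivAt F (fderiv ℝ F z) (τ 0) := by
      rw [hτ0]
      exact ((hF.contDiffAt (hO.mem_nhds hz)).differentiableAt (by simp)).hasFDerivAt
    have h3 := ρ.hasFDerivAt.comp (0 : K) ((h2.comp (0 : K) h1).sub_const (F z))
    refine h3.congr_fderiv (ContinuousLinearMap.ext fun k => ?_)
    change ρ (fderiv ℝ F z (R k)) = k
    rw [hR, hρ]
  -- The increment of `F` already lies in `K`, so `ρ` loses nothing.
  have hFG : ∀ k ∈ O', F (τ k) = F z + G k := fun k hk => by
    have := congrArg Subtype.val (hρ ⟨_, hK _ hk⟩)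
    rw [hGdef]
    dsimp only at this ⊢
    rw [this]
    abel
  obtain ⟨g, U, hU, h0U, hg, hgO, hgG⟩ := hG.exists_contDiffOn_localInverse hO'_open h0 hGd
  rw [hG0] at h0U
  have hκ : ContDiff ℝ ∞ fun w => ρ (w - F z) := ρ.contDiff.comp (contDiff_id.sub contDiff_const)
  refine ⟨fun w => τ (g (ρ (w - F z))), (fun w => ρ (w - F z)) ⁻¹' U, hU.preimage hκ.continuous,
    by simpa using h0U, hτ_smooth.comp_contDiffOn (hg.comp hκ.contDiffOn fun w hw => hw),
    fun w hw => hgO hw, fun w hw hwK => ?_⟩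
  rw [hFG _ (hgO hw), hgG _ hw]
  have := congrArg Subtype.val (hρ ⟨_, hwK⟩)
  dsimp only at this
  rw [this]
  abel

section Manifold

variable {E' H' M : Type*} [NormedAddCommGroup E'] [NormedSpace ℝ E']
  [TopologicalSpace H'] {I : ModelWithCorners ℝ E' H'} [I.Boundaryless]
  [TopologicalSpace M] [ChartedSpace H' M]

/-- The segment `m + s • k` stays in the slice for small `s`, so a function vanishing on `S` is zero
along it. Only this inclusion between slice directions and the annihilator-defined tangent space is
needed. -/
theorem mfderiv_extend_symm_mem_tangentSpaceTo {S : Set M} {p : M}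
    {φ : OpenPartialHomeomorph M H'} (hφ : φ ∈ IsManifold.maximalAtlas I ∞ M)
    (hpφ : p ∈ φ.source) {K : Submodule ℝ E'}
    (hK : ∀ x ∈ φ.source, x ∈ S ↔ φ.extend I x - φ.extend I p ∈ K) {k : E'} (hk : k ∈ K) :
    ∃ u ∈ tangentSpaceTo I S p, mfderiv I 𝓘(ℝ, E') (φ.extend I) p u = k := by
  set m := φ.extend I p with hm
  have htarget : IsOpen (φ.extend I).target := φ.isOpen_extend_target
  have hps : p ∈ (φ.extend I).source := by rwa [φ.extend_source]
  have hmt : m ∈ (φ.extend I).target := (φ.extend I).map_source hps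
  have hinv : (φ.extend I).symm m = p := (φ.extend I).left_inv hps
  have hd1 : MDifferentiableAt 𝓘(ℝ, E') I (φ.extend I).symm m := by
    have := contMDiffOn_extend_symm hφ
    rw [← φ.extend_target'] at this
    exact (this.contMDiffAt (htarget.mem_nhds hmt)).mdifferentiableAt (by simp)
  have hd2 : MDifferentiableAt I 𝓘(ℝ, E') (φ.extend I) ((φ.extend I).symm m) := by
    rw [hinv]
    exact (φ.contMDiffAt_extend hφ hpφ).mdifferentiableAt (by simp)
  rw [← hinv]
  refine ⟨mfderiv 𝓘(ℝ, E') I (φ.extend I).symm m k, fun f hf h0 => ?_, ?_⟩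
  · have hdf : MDifferentiableAt I 𝓘(ℝ, ℝ) f ((φ.extend I).symm m) :=
      hf.contMDiffAt.mdifferentiableAt (by simp)
    have hdg : DifferentiableAt ℝ (f ∘ (φ.extend I).symm) m :=
      (hdf.comp m hd1).differentiableAt
    have hchain := mfderiv_comp_apply (v := k) m hdf hd1
    rw [mfderiv_eq_fderiv] at hchain
    refine hchain.symm.trans ?_
    have hline : HasDerivAt (fun s : ℝ => m + s • k) k 0 := by
      simpa using ((hasDerivAt_id (0 : ℝ)).smul_const k).const_add m
    have hcomp : HasDerivAt ((f ∘ (φ.extend I).symm) ∘ fun s : ℝ => m + s • k)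
        (fderiv ℝ (f ∘ (φ.extend I).symm) m k) 0 :=
      HasFDerivAt.comp_hasDerivAt (0 : ℝ) (by simpa using hdg.hasFDerivAt) hline
    refine hcomp.unique ((hasDerivAt_const (0 : ℝ) (0 : ℝ)).congr_of_eventuallyEq ?_)
    have hnear : ∀ᶠ s : ℝ in 𝓝 0, m + s • k ∈ (φ.extend I).target :=
      hline.continuousAt.eventually_mem
        (by simpa only [zero_smul, add_zero] using htarget.mem_nhds hmt)
    filter_upwards [hnear] with s hs
    refine h0 _ ((hK _ ?_).2 ?_)
    · rw [← φ.extend_source (I := I)]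
      exact (φ.extend I).map_target hs
    · rw [(φ.extend I).right_inv hs]
      simpa using K.smul_mem s hk
  · refine (mfderiv_comp_apply (v := k) m hd2 hd1).symm.trans ?_
    have hev : φ.extend I ∘ (φ.extend I).symm =ᶠ[𝓝 m] id := by
      filter_upwards [htarget.mem_nhds hmt] with x hx using (φ.extend I).right_inv hx
    rw [hev.mfderiv_eq, mfderiv_id]
    rfl

variable [FiniteDimensional ℝ E'] {E'' H'' N : Type*} [NormedAddCommGroup E'']
  [NormedSpace ℝ E''] [FiniteDimensional ℝ E''] [TopologicalSpace H'']
  {J : ModelWithCorners ℝ E'' H''} [J.Boundaryless] [TopologicalSpace N] [ChartedSpace H'' N]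
  [IsManifold J ∞ N]

theorem IsEmbeddedSubmanifold.exists_contMDiffOn_local_extension {f : N → M}
    (hS : IsEmbeddedSubmanifold I (range f)) (hf : ContMDiff J I ∞ f) {e : N → ℝ}
    (he : ContMDiff J 𝓘(ℝ, ℝ) ∞ e) (hef : ∀ v w, f v = f w → e v = e w) (v : N)
    (hsub : ∀ u ∈ tangentSpaceTo I (range f) (f v), ∃ w, mfderiv J I f v w = u) :
    ∃ U ∈ 𝓝 (f v), ∃ g : M → ℝ, ContMDiffOn I 𝓘(ℝ, ℝ) ∞ g U ∧ ∀ w, f w ∈ U → g (f w) = e w := by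
  obtain ⟨φ, hφ, hpφ, K, hK⟩ := hS (f v) (mem_range_self v)
  set T := extChartAt J v
  set F : E'' → E' := φ.extend I ∘ f ∘ T.symm with hFdef
  have hfT : ContMDiffOn 𝓘(ℝ, E'') I ∞ (f ∘ T.symm) T.target :=
    hf.comp_contMDiffOn (contMDiffOn_extChartAt_symm v)
  have hTt : IsOpen T.target := isOpen_extChartAt_target v
  set O := T.target ∩ (f ∘ T.symm) ⁻¹' φ.source with hOdef
  have hO : IsOpen O := hfT.continuousOn.isOpen_inter_preimage hTt φ.open_source
  have hTv : T.symm (T v) = v := extChartAt_to_inv v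
  have hz : T v ∈ O := ⟨mem_extChartAt_target v, by simpa [hTv] using hpφ⟩
  have hF : ContDiffOn ℝ ∞ F O := contMDiffOn_iff_contDiffOn.1 fun z hz' =>
    (φ.contMDiffAt_extend hφ hz'.2).comp_contMDiffWithinAt z
      ((hfT z hz'.1).mono inter_subset_left)
  have hFv : F (T v) = φ.extend I (f v) := by simp only [hFdef, Function.comp_apply, hTv]
  have hFK : ∀ z ∈ O, F z - F (T v) ∈ K := fun z hz' => by
    rw [hFv]
    exact (hK _ hz'.2).1 (mem_range_self _)
  -- A slice direction is tangent to the image, hence hit by the derivative of `f`.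
  have hr : ∀ k ∈ K, ∃ u, fderiv ℝ F (T v) u = k := fun k hk => by
    obtain ⟨u, hu, rfl⟩ := mfderiv_extend_symm_mem_tangentSpaceTo hφ hpφ hK hk
    obtain ⟨w, rfl⟩ := hsub u hu
    have hd1 : MDifferentiableAt J 𝓘(ℝ, E'') T v :=
      mdifferentiableAt_extChartAt (mem_chart_source _ v)
    have hd2 : MDifferentiableAt 𝓘(ℝ, E'') 𝓘(ℝ, E') F (T v) :=
      ((hF.contDiffAt (hO.mem_nhds hz)).differentiableAt (by simp)).mdifferentiableAt
    have hd3 : MDifferentiableAt J I f v := hf.contMDiffAt.mdifferentiableAt (by simp)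
    have hd4 : MDifferentiableAt I 𝓘(ℝ, E') (φ.extend I) (f v) :=
      (φ.contMDiffAt_extend hφ hpφ).mdifferentiableAt (by simp)
    refine ⟨mfderiv J 𝓘(ℝ, E'') T v w, ?_⟩
    have hev : F ∘ T =ᶠ[𝓝 v] φ.extend I ∘ f := by
      filter_upwards [extChartAt_source_mem_nhds (I := J) v] with x hx
      simp only [hFdef, Function.comp_apply, T.left_inv hx]
    rw [← mfderiv_eq_fderiv]
    refine (mfderiv_comp_apply (v := w) v hd2 hd1).symm.trans ?_
    rw [hev.mfderiv_eq]
    exact mfderiv_comp_apply (v := w) v hd4 hd3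
  obtain ⟨σ, U, hU, hzU, hσ, hσO, hσF⟩ := hF.exists_contDiffOn_section hO hz hFK hr
  have hφc := φ.contMDiffOn_extend (I := I) hφ
  refine ⟨φ.source ∩ φ.extend I ⁻¹' U,
    (hφc.continuousOn.isOpen_inter_preimage φ.open_source hU).mem_nhds 
      ⟨hpφ, by rwa [mem_preimage, ← hFv]⟩,
    -- Near `f v`, the extension is `e` evaluated along the local section.
    e ∘ T.symm ∘ σ ∘ φ.extend I, ?_, fun w hw => hef _ _ ?_⟩
  · exact he.comp_contMDiffOn ((contMDiffOn_extChartAt_symm v).comp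
      (hσ.contMDiffOn.comp (hφc.mono inter_subset_left) fun x hx => hx.2)
      fun x hx => (hσO hx.2).1)
  -- The section may return a point other than `w`, but one in the same fibre of `f`, where `e`
  -- agrees by `hef`.
  · have h1 := hσF _ hw.2 (by rw [hFv]; exact (hK _ hw.1).1 (mem_range_self w))
    refine (φ.extend I).injOn ?_ ?_ h1
    · rw [φ.extend_source]; exact (hσO hw.2).2
    · rw [φ.extend_source]; exact hw.1

theorem IsEmbeddedSubmanifold.exists_contMDiff_extension [IsManifold I ∞ M] [T2Space M]
    [SigmaCompactSpace M] {f : N → M} (hclosed : IsClosed (range f))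
    (hS : IsEmbeddedSubmanifold I (range f)) (hf : ContMDiff J I ∞ f) {e : N → ℝ} (he : ContMDiff J 𝓘(ℝ, ℝ) ∞ e)
    (hef : ∀ v w, f v = f w → e v = e w)
    (hsub : ∀ v, ∀ u ∈ tangentSpaceTo I (range f) (f v), ∃ w, mfderiv J I f v w = u) :
    ∃ g : M → ℝ, ContMDiff I 𝓘(ℝ, ℝ) ∞ g ∧ ∀ w, g (f w) = e w := by
  obtain ⟨g, hg⟩ := exists_contMDiffMap_forall_mem_convex_of_local (n := (⊤ : ℕ∞)) (I := I)
    -- Over the image the only admissible value is that of `e`; elsewhere every value is. These sets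
    -- are convex, so the local extensions can be averaged.
    (t := fun x : M => {r : ℝ | ∀ w, f w = x → r = e w})
    (fun x r hr s hs a b _ _ hab w hw => by
      rw [hr w hw, hs w hw, ← add_smul, hab, one_smul])
    (fun x => by
      by_cases hx : x ∈ range f
      · obtain ⟨v, rfl⟩ := hx
        obtain ⟨U, hU, g, hg, hgU⟩ := hS.exists_contMDiffOn_local_extension hf he hef v (hsub v)
        refine ⟨U, hU, g, hg, ?_⟩
        rintro y hy w rfl
        exact hgU w hy
      -- Closedness leaves a neighbourhood free of constraints, where zero will do.
      · refine ⟨_, hclosed.isOpen_compl.mem_nhds hx, fun _ => 0, contMDiffOn_const, ?_⟩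
        rintro y hy w rfl
        exact absurd (mem_range_self w) hy)
  exact ⟨g, g.contMDiff, fun w => hg (f w) w rfl⟩

end Manifold

/-! ## Solutions of the Euler-Lagrange equations -/

section Solutions

variable {E Q : Type*} [NormedAddCommGroup E] [NormedSpace ℝ E]
  [TopologicalSpace Q] [ChartedSpace E Q]
  {l : TangentBundle 𝓘(ℝ, E) Q → ℝ} {γ : ℝ → Q} {J : Set ℝ}

theorem jetOne_comp_add_right {t s : ℝ} (hγ : MDifferentiableAt 𝓘(ℝ, ℝ) 𝓘(ℝ, E) γ (s + t)) :
    jetOne (E := E) (fun r => γ (r + t)) s = jetOne γ (s + t) := by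
  have hadd : HasFDerivAt (fun r : ℝ => r + t) (ContinuousLinearMap.id ℝ ℝ) s :=
    (hasFDerivAt_id s).add_const t
  have h := (hγ.hasMFDerivAt.comp s hadd.hasMFDerivAt).mfderiv
  exact congrArg (fun A : ℝ →L[ℝ] E => (⟨γ (s + t), A 1⟩ : TangentBundle 𝓘(ℝ, E) Q)) h

theorem IsEulerLagrangeSolutionOn.mdifferentiableAt (hγ : IsEulerLagrangeSolutionOn l γ J)
    (hJ : IsOpen J) {t : ℝ} (ht : t ∈ J) : MDifferentiableAt 𝓘(ℝ, ℝ) 𝓘(ℝ, E) γ t :=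
  (hγ.1.contMDiffAt (hJ.mem_nhds ht)).mdifferentiableAt (by simp)

theorem IsEulerLagrangeSolutionOn.comp_add_right (hγ : IsEulerLagrangeSolutionOn l γ J) (t : ℝ) :
    IsEulerLagrangeSolutionOn l (fun s => γ (s + t)) ((fun s => s + t) ⁻¹' J) := by
  refine ⟨hγ.1.comp ((contDiff_id.add contDiff_const).contMDiff.contMDiffOn) fun s hs => hs,
    fun s hs φ hφ hsφ => ?_⟩
  have h := (hγ.2 (s + t) hs φ hφ hsφ).comp_add_const s t
  have hd (r : ℝ) : deriv (fun r => φ (γ (r + t))) r = deriv (fun r => φ (γ r)) (r + t) :=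
    deriv_comp_add_const (fun r => φ (γ r)) t r
  simpa only [hd] using h

theorem IsEulerLagrangeSolutionOn.mono (hγ : IsEulerLagrangeSolutionOn l γ J) {J' : Set ℝ}
    (hJ : J' ⊆ J) : IsEulerLagrangeSolutionOn l γ J' :=
  ⟨hγ.1.mono hJ, fun t ht => hγ.2 t (hJ ht)⟩

/-- The equations are autonomous, so a time shift turns the jet at any time into an initial
velocity. -/
theorem IsEulerLagrangeSolutionOn.jetOne_mem_initialDataConstraint
    (hγ : IsEulerLagrangeSolutionOn l γ J) (hJ : IsOpen J) {t : ℝ} (ht : t ∈ J) :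
    jetOne γ t ∈ initialDataConstraint l := by
  obtain ⟨ε, hε, hball⟩ := Metric.isOpen_iff.1 hJ t ht
  refine ⟨ε, hε, fun s => γ (s + t), (hγ.comp_add_right t).mono fun s hs => hball ?_, ?_⟩
  · simpa [Real.dist_eq, abs_lt] using hs
  · rw [jetOne_comp_add_right (by rw [zero_add]; exact hγ.mdifferentiableAt hJ ht), zero_add]

variable [IsManifold 𝓘(ℝ, E) ∞ Q]

/-- The first jet of a curve in the chart of `TQ` at a point over `q`. -/
def localJet (γ : ℝ → Q) (q : Q) (s : ℝ) : E × E :=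
  (chartAt E q (γ s), deriv (fun r => chartAt E q (γ r)) s)

theorem extChartAt_symm_localJet (v : TangentBundle 𝓘(ℝ, E) Q) {s : ℝ}
    (hγ : MDifferentiableAt 𝓘(ℝ, ℝ) 𝓘(ℝ, E) γ s) (hs : γ s ∈ (chartAt E v.1).source) :
    (extChartAt 𝓘(ℝ, E).tangent v).symm (localJet γ v.1 s) = jetOne γ s := by
  have hchart : MDifferentiableAt 𝓘(ℝ, E) 𝓘(ℝ, E) (chartAt E v.1) (γ s) :=
    mdifferentiableAt_atlas (chart_mem_atlas E v.1) hs
  have hsymm : MDifferentiableAt 𝓘(ℝ, E) 𝓘(ℝ, E) (chartAt E v.1).symm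
      ((chartAt E v.1 ∘ γ) s) :=
    mdifferentiableAt_atlas_symm (chart_mem_atlas E v.1) ((chartAt E v.1).map_source hs)
  have hev : (chartAt E v.1).symm ∘ (chartAt E v.1 ∘ γ) =ᶠ[𝓝 s] γ := by
    filter_upwards [hγ.continuousAt.preimage_mem_nhds
      ((chartAt E v.1).open_source.mem_nhds hs)] with r hr using (chartAt E v.1).left_inv hr
  have hcomp := mfderiv_comp_apply (v := (1 : ℝ)) s hsymm (hchart.comp s hγ)
  rw [hev.mfderiv_eq] at hcomp
  refine (tangent_extChartAt_symm_chart v _ hs).trans ?_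
  refine congrArg (fun w : E => (⟨γ s, w⟩ : TangentBundle 𝓘(ℝ, E) Q)) (Eq.trans ?_ hcomp.symm)
  rw [mfderiv_eq_fderiv]
  rfl

theorem IsEulerLagrangeSolutionOn.eventually_localJet_mem
    (hγ : IsEulerLagrangeSolutionOn l γ J) (hJ : IsOpen J) {t : ℝ} (ht : t ∈ J) :
    ∀ᶠ s in 𝓝 t, localJet γ (γ t) s ∈
      (extChartAt 𝓘(ℝ, E).tangent (jetOne (E := E) γ t)).target := by
  filter_upwards [(hγ.mdifferentiableAt hJ ht).continuousAt.preimage_mem_nhds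
    (chart_source_mem_nhds E (γ t))] with s hs
  rw [tangent_extChartAt_target]
  exact ⟨(chartAt E (γ t)).map_source hs, mem_univ _⟩

/-- The Euler-Lagrange equation is itself the derivative of the momentum component, so no second
derivative of `γ` is computed. -/
theorem IsEulerLagrangeSolutionOn.hasDerivAt_fibreDeriv_localJet
    (hl : ContMDiff 𝓘(ℝ, E).tangent 𝓘(ℝ, ℝ) ∞ l)
    (hγ : IsEulerLagrangeSolutionOn l γ J) (hJ : IsOpen J) {t : ℝ} (ht : t ∈ J) :
    HasDerivAt (fun s => fibreDeriv (lagrangianAt l (γ t)) (localJet γ (γ t) s))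
      ((localJet γ (γ t) t).2,
        (fderiv ℝ (lagrangianAt l (γ t)) (localJet γ (γ t) t)).comp
          (ContinuousLinearMap.inl ℝ E E)) t := by
  have hel := hγ.2 t ht _ (chart_mem_atlas E (γ t)) (mem_chart_source E (γ t))
  have hev := hγ.eventually_localJet_mem hJ ht
  have hz := hev.self_of_nhds
  have hx : (fderiv ℝ (lagrangianAt l (γ t)) (localJet γ (γ t) t)).comp
      (ContinuousLinearMap.inl ℝ E E) = _ :=
    (fderiv_prodMk_right (differentiableAt_lagrangianAt hl (jetOne γ t) hz)).symm
  rw [hx]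
  refine HasDerivAt.prodMk ?_ (hel.congr_of_eventuallyEq ?_)
  · have hd : DifferentiableAt ℝ (chartAt E (γ t) ∘ γ) t :=
      (MDifferentiableAt.comp t (mdifferentiableAt_atlas (I := 𝓘(ℝ, E)) (chart_mem_atlas E (γ t))
        (mem_chart_source E (γ t))) (hγ.mdifferentiableAt hJ ht)).differentiableAt
    exact hd.hasDerivAt
  · filter_upwards [hev] with s hs
    exact (fderiv_prodMk_left (differentiableAt_lagrangianAt hl (jetOne γ t) hs)).symm

theorem IsEulerLagrangeSolutionOn.extChartAt_legendre_jetOne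
    (hl : ContMDiff 𝓘(ℝ, E).tangent 𝓘(ℝ, ℝ) ∞ l)
    (hγ : IsEulerLagrangeSolutionOn l γ J) (hJ : IsOpen J) {t : ℝ} (ht : t ∈ J) :
    extChartAt (cotangentModel E) (legendre l (jetOne γ t)) ∘ (fun s => legendre l (jetOne γ s))
      =ᶠ[𝓝 t] fun s => fibreDeriv (lagrangianAt l (γ t)) (localJet γ (γ t) s) := by
  filter_upwards [hγ.eventually_localJet_mem hJ ht, hJ.mem_nhds ht,
    (hγ.mdifferentiableAt hJ ht).continuousAt.preimage_mem_nhds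
      (chart_source_mem_nhds E (γ t))] with s hs hsJ hsγ
  rw [Function.comp_apply, ← extChartAt_symm_localJet (jetOne γ t)
    (hγ.mdifferentiableAt hJ hsJ) hsγ]
  exact extChartAt_legendre hl (jetOne γ t) hs

theorem IsEulerLagrangeSolutionOn.mdifferentiableAt_legendre_jetOne
    (hl : ContMDiff 𝓘(ℝ, E).tangent 𝓘(ℝ, ℝ) ∞ l)
    (hγ : IsEulerLagrangeSolutionOn l γ J) (hJ : IsOpen J) {t : ℝ} (ht : t ∈ J) :
    MDifferentiableAt 𝓘(ℝ, ℝ) (cotangentModel E) (fun s => legendre l (jetOne γ s)) t := by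
  have hev := hγ.extChartAt_legendre_jetOne hl hJ ht
  have hd := (hγ.hasDerivAt_fibreDeriv_localJet hl hJ ht).differentiableAt.mdifferentiableAt
  set p := legendre l (jetOne (E := E) γ t) with hp
  have hpt : fibreDeriv (lagrangianAt l (γ t)) (localJet γ (γ t) t) =
      extChartAt (cotangentModel E) p p := hev.self_of_nhds.symm
  have hs : MDifferentiableAt 𝓘(ℝ, E × (E →L[ℝ] ℝ)) (cotangentModel E)
      (extChartAt (cotangentModel E) p).symm
      (fibreDeriv (lagrangianAt l (γ t)) (localJet γ (γ t) t)) := by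
    rw [hpt]
    exact ((contMDiffOn_extChartAt_symm (n := ∞) p).contMDiffAt
      (extChartAt_target_mem_nhds p)).mdifferentiableAt (by simp)
  refine (hs.comp t hd).congr_of_eventuallyEq ?_
  filter_upwards [hev, (hγ.mdifferentiableAt hJ ht).continuousAt.preimage_mem_nhds
      (chart_source_mem_nhds E (γ t))] with s hs hsγ
  rw [Function.comp_apply, ← hs, Function.comp_apply, PartialEquiv.left_inv]
  rw [cotangent_extChartAt_source]
  exact hsγ

theorem IsEulerLagrangeSolutionOn.mfderiv_extChartAt_mfderiv_legendre_jetOne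
    (hl : ContMDiff 𝓘(ℝ, E).tangent 𝓘(ℝ, ℝ) ∞ l)
    (hγ : IsEulerLagrangeSolutionOn l γ J) (hJ : IsOpen J) {t : ℝ} (ht : t ∈ J) :
    mfderiv (cotangentModel E) 𝓘(ℝ, E × (E →L[ℝ] ℝ))
      (extChartAt (cotangentModel E) (legendre l (jetOne γ t))) (legendre l (jetOne γ t))
      (mfderiv 𝓘(ℝ, ℝ) (cotangentModel E) (fun s => legendre l (jetOne γ s)) t (1 : ℝ)) =
      ((localJet γ (γ t) t).2,
        (fderiv ℝ (lagrangianAt l (γ t)) (localJet γ (γ t) t)).comp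
          (ContinuousLinearMap.inl ℝ E E)) := by
  have hev := hγ.extChartAt_legendre_jetOne hl hJ ht
  have hd := hγ.hasDerivAt_fibreDeriv_localJet hl hJ ht
  have hc : MDifferentiableAt (cotangentModel E) 𝓘(ℝ, E × (E →L[ℝ] ℝ))
      (extChartAt (cotangentModel E) (legendre l (jetOne γ t))) (legendre l (jetOne γ t)) :=
    mdifferentiableAt_extChartAt (mem_chart_source _ _)
  refine (mfderiv_comp_apply (v := (1 : ℝ)) t hc
    (hγ.mdifferentiableAt_legendre_jetOne hl hJ ht)).symm.trans ?_
  rw [hev.mfderiv_eq, mfderiv_eq_fderiv, ← hd.deriv]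
  rfl

/-! ### Differentials of the Legendre map and the energy, and Hamilton's equation -/

theorem mfderiv_extChartAt_mfderiv_legendre
    (hl : ContMDiff 𝓘(ℝ, E).tangent 𝓘(ℝ, ℝ) ∞ l) (v : TangentBundle 𝓘(ℝ, E) Q)
    (w : TangentSpace 𝓘(ℝ, E).tangent v) :
    mfderiv (cotangentModel E) 𝓘(ℝ, E × (E →L[ℝ] ℝ))
      (extChartAt (cotangentModel E) (legendre l v)) (legendre l v)
      (mfderiv 𝓘(ℝ, E).tangent (cotangentModel E) (legendre l) v w) =
    fderiv ℝ (fibreDeriv (lagrangianAt l v.1)) (extChartAt 𝓘(ℝ, E).tangent v v)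
      (mfderiv 𝓘(ℝ, E).tangent 𝓘(ℝ, E × E) (extChartAt 𝓘(ℝ, E).tangent v) v w) := by
  have hc : MDifferentiableAt (cotangentModel E) 𝓘(ℝ, E × (E →L[ℝ] ℝ))
      (extChartAt (cotangentModel E) (legendre l v)) (legendre l v) :=
    mdifferentiableAt_extChartAt (mem_chart_source _ _)
  have hv : MDifferentiableAt 𝓘(ℝ, E).tangent 𝓘(ℝ, E × E) (extChartAt 𝓘(ℝ, E).tangent v) v :=
    mdifferentiableAt_extChartAt (mem_chart_source _ _)
  have hL := (((contDiffOn_lagrangianAt hl v).fibreDeriv (isOpen_extChartAt_target v)).contDiffAt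
    (extChartAt_target_mem_nhds v)).differentiableAt (by simp) |>.mdifferentiableAt
  have hev : extChartAt (cotangentModel E) (legendre l v) ∘ legendre l =ᶠ[𝓝 v]
      fibreDeriv (lagrangianAt l v.1) ∘ extChartAt 𝓘(ℝ, E).tangent v := by
    filter_upwards [extChartAt_source_mem_nhds (I := 𝓘(ℝ, E).tangent) v] with x hx
    rw [Function.comp_apply, Function.comp_apply,
      ← extChartAt_legendre hl v ((extChartAt 𝓘(ℝ, E).tangent v).map_source hx),
      (extChartAt 𝓘(ℝ, E).tangent v).left_inv hx]
  refine (mfderiv_comp_apply (v := w) v hc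
    ((contMDiff_legendre hl).mdifferentiableAt (by simp))).symm.trans ?_
  rw [hev.mfderiv_eq, ← mfderiv_eq_fderiv]
  exact mfderiv_comp_apply (v := w) v hL hv

theorem differential_energy_apply
    (hl : ContMDiff 𝓘(ℝ, E).tangent 𝓘(ℝ, ℝ) ∞ l) (v : TangentBundle 𝓘(ℝ, E) Q)
    (w : TangentSpace 𝓘(ℝ, E).tangent v) :
    differential 𝓘(ℝ, E).tangent (energy l) v w =
    fderiv ℝ (localEnergy (lagrangianAt l v.1)) (extChartAt 𝓘(ℝ, E).tangent v v)
      (mfderiv 𝓘(ℝ, E).tangent 𝓘(ℝ, E × E) (extChartAt 𝓘(ℝ, E).tangent v) v w) := by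
  have hv : MDifferentiableAt 𝓘(ℝ, E).tangent 𝓘(ℝ, E × E) (extChartAt 𝓘(ℝ, E).tangent v) v :=
    mdifferentiableAt_extChartAt (mem_chart_source _ _)
  have hL := (((contDiffOn_lagrangianAt hl v).localEnergy (isOpen_extChartAt_target v)).contDiffAt
    (extChartAt_target_mem_nhds v)).differentiableAt (by simp) |>.mdifferentiableAt
  have hev : energy l =ᶠ[𝓝 v]
      localEnergy (lagrangianAt l v.1) ∘ extChartAt 𝓘(ℝ, E).tangent v := by
    filter_upwards [extChartAt_source_mem_nhds (I := 𝓘(ℝ, E).tangent) v] with x hx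
    rw [Function.comp_apply,
      ← energy_extChartAt_symm hl v ((extChartAt 𝓘(ℝ, E).tangent v).map_source hx),
      (extChartAt 𝓘(ℝ, E).tangent v).left_inv hx]
  rw [differential, hev.mfderiv_eq, ← mfderiv_eq_fderiv]
  exact mfderiv_comp_apply (v := w) v hL hv

theorem fderiv_fibreDeriv_fst {F : E × E → ℝ} {z : E × E}
    (hF : DifferentiableAt ℝ (fderiv ℝ F) z) (w : E × E) :
    (fderiv ℝ (fibreDeriv F) z w).1 = w.1 := by
  have h := hasFDerivAt_fst.prodMk
    (hF.hasFDerivAt.clm_comp (hasFDerivAt_const (ContinuousLinearMap.inr ℝ E E) z))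
  exact congrArg Prod.fst (DFunLike.congr_fun h.fderiv w)

/-- Differentiating `F_y y` gives a term `F_y w.2`, which cancels the fibre part of `dF`. -/
theorem fderiv_localEnergy {F : E × E → ℝ} {z : E × E} (hF1 : DifferentiableAt ℝ F z)
    (hF : DifferentiableAt ℝ (fderiv ℝ F) z) (w : E × E) :
    fderiv ℝ (localEnergy F) z w =
      (fderiv ℝ (fibreDeriv F) z w).2 z.2 - fderiv ℝ F z (w.1, 0) := by
  have hd : DifferentiableAt ℝ (fibreDeriv F) z :=
    differentiableAt_fst.prodMk (hF.clm_comp (differentiableAt_const _))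
  have h := ((hd.hasFDerivAt.snd).clm_apply hasFDerivAt_snd).sub hF1.hasFDerivAt
  have h' := DFunLike.congr_fun h.fderiv w
  have hw : fderiv ℝ F z w = fderiv ℝ F z (w.1, 0) + fderiv ℝ F z (0, w.2) := by
    rw [← map_add]; simp
  refine h'.trans ?_
  simp [fibreDeriv, hw]
  ring

/-- The first two terms are the canonical form of `(y, F_x)` against the image of `w`, arranged as
in `symplecticForm_apply`. -/
theorem fderiv_localEnergy_hamilton {F : E × E → ℝ} {z : E × E} (hF1 : DifferentiableAt ℝ F z)
    (hF : DifferentiableAt ℝ (fderiv ℝ F) z) (w : E × E) :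
    (fderiv ℝ F z).comp (ContinuousLinearMap.inl ℝ E E) (fderiv ℝ (fibreDeriv F) z w).1 -
      (fderiv ℝ (fibreDeriv F) z w).2 z.2 + fderiv ℝ (localEnergy F) z w = 0 := by
  rw [fderiv_localEnergy hF1 hF, fderiv_fibreDeriv_fst hF]
  simp

/-- The Hamilton equation pulled back to the tangent bundle by the Legendre transformation. -/
theorem IsEulerLagrangeSolutionOn.symplecticForm_add_differential_energy
    (hl : ContMDiff 𝓘(ℝ, E).tangent 𝓘(ℝ, ℝ) ∞ l)
    (hγ : IsEulerLagrangeSolutionOn l γ J) (hJ : IsOpen J) {t : ℝ} (ht : t ∈ J)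
    (w : TangentSpace 𝓘(ℝ, E).tangent (jetOne (E := E) γ t)) :
    symplecticForm (legendre l (jetOne γ t))
      (mfderiv 𝓘(ℝ, ℝ) (cotangentModel E) (fun s => legendre l (jetOne γ s)) t (1 : ℝ))
      (mfderiv 𝓘(ℝ, E).tangent (cotangentModel E) (legendre l) (jetOne γ t) w) +
      differential 𝓘(ℝ, E).tangent (energy l) (jetOne γ t) w = 0 := by
  have hF := ((contDiffOn_lagrangianAt hl (jetOne (E := E) γ t)).contDiffAt
    (extChartAt_target_mem_nhds _))
  have hF1 := hF.differentiableAt (by simp)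
  have hF2 := (hF.fderiv_right (m := ∞) (by simp)).differentiableAt (by simp)
  -- The coordinate jet of `γ` is the coordinate of the point `j¹γ(t)`, so all local formulas are
  -- evaluated at the same `z`.
  have hz : localJet γ (γ t) t =
      extChartAt 𝓘(ℝ, E).tangent (jetOne (E := E) γ t) (jetOne γ t) := by
    exact ((extChartAt 𝓘(ℝ, E).tangent (jetOne (E := E) γ t)).right_inv
      (hγ.eventually_localJet_mem hJ ht).self_of_nhds).symm.trans (congrArg _
        (extChartAt_symm_localJet (jetOne γ t) (hγ.mdifferentiableAt hJ ht)
          (mem_chart_source E (γ t))))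
  have hu := hγ.mfderiv_extChartAt_mfderiv_legendre_jetOne hl hJ ht
  rw [hz] at hu
  exact (congrArg₂ (· + ·)
    (symplecticForm_apply _ _ _ _ _ hu (mfderiv_extChartAt_mfderiv_legendre hl _ w))
    (differential_energy_apply hl _ w)).trans (fderiv_localEnergy_hamilton hF1 hF2 _)

/-- The curve stays in `𝒞` for all times near `t`, so functions vanishing on `𝒞` are locally zero
along it. -/
theorem IsEulerLagrangeSolutionOn.mfderiv_legendre_jetOne_mem
    (hl : ContMDiff 𝓘(ℝ, E).tangent 𝓘(ℝ, ℝ) ∞ l)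
    (hγ : IsEulerLagrangeSolutionOn l γ J) (hJ : IsOpen J) {t : ℝ} (ht : t ∈ J) :
    mfderiv 𝓘(ℝ, ℝ) (cotangentModel E) (fun s => legendre l (jetOne γ s)) t (1 : ℝ) ∈
      tangentSpaceTo (cotangentModel E) (constraintSet l) (legendre l (jetOne γ t)) := by
  intro f hf h0
  have hev : f ∘ (fun s => legendre l (jetOne γ s)) =ᶠ[𝓝 t] fun _ => (0 : ℝ) := by
    filter_upwards [hJ.mem_nhds ht] with s hs
    exact h0 _ ⟨_, hγ.jetOne_mem_initialDataConstraint hJ hs, rfl⟩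
  refine (mfderiv_comp_apply (v := (1 : ℝ)) t (hf.mdifferentiableAt (by simp))
    (hγ.mdifferentiableAt_legendre_jetOne hl hJ ht)).symm.trans ?_
  rw [hev.mfderiv_eq, mfderiv_const]
  rfl

end Solutions

end

/-! ### Hamilton's equation on the constraint set -/

theorem mainTheorem4
    {E Q : Type*} [NormedAddCommGroup E] [NormedSpace ℝ E] [FiniteDimensional ℝ E]
    [TopologicalSpace Q] [T2Space Q] [SecondCountableTopology Q]
    [ChartedSpace E Q] [IsManifold 𝓘(ℝ, E) ∞ Q]
    (l : TangentBundle 𝓘(ℝ, E) Q → ℝ) (hl : ContMDiff 𝓘(ℝ, E).tangent 𝓘(ℝ, ℝ) ∞ l)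
    (hP_closed : IsClosed (primaryConstraintSet l))
    (hP : IsEmbeddedSubmanifold (cotangentModel E) (primaryConstraintSet l))
    (hsub : LegendreIsSubmersion l)
    (h : primaryConstraintSet l → ℝ)
    (he : ∀ v, energy l v = h ⟨legendre l v, Set.mem_range_self v⟩) :
    -- the push-forward `h` of the energy extends to a smooth function on `T*Q`
    (∃ H : CotangentBundle E Q → ℝ,
      ContMDiff (cotangentModel E) 𝓘(ℝ, ℝ) ∞ H ∧ ∀ p : primaryConstraintSet l, H p = h p) ∧
    -- and the Hamiltonian equation holds, with `dh_𝒞` computed from any smooth function `H` that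
    -- restricts to `h` on `𝒞`
    ∀ H : CotangentBundle E Q → ℝ, ContMDiff (cotangentModel E) 𝓘(ℝ, ℝ) ∞ H →
      (∀ p : primaryConstraintSet l, (p : CotangentBundle E Q) ∈ constraintSet l → H p = h p) →
      ∀ (J : Set ℝ), IsOpen J → ∀ γ : ℝ → Q, IsEulerLagrangeSolutionOn l γ J →
        ∀ t ∈ J,
          legendre l (jetOne γ t) ∈ constraintSet l ∧
          MDifferentiableAt 𝓘(ℝ, ℝ) (cotangentModel E) (fun s => legendre l (jetOne γ s)) t ∧
          mfderiv 𝓘(ℝ, ℝ) (cotangentModel E) (fun s => legendre l (jetOne γ s)) t (1 : ℝ) ∈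
            tangentSpaceTo (cotangentModel E) (constraintSet l) (legendre l (jetOne γ t)) ∧
          ∀ u ∈ tangentSpaceTo (cotangentModel E) (constraintSet l) (legendre l (jetOne γ t)),
            symplecticForm (legendre l (jetOne γ t))
                (mfderiv 𝓘(ℝ, ℝ) (cotangentModel E) (fun s => legendre l (jetOne γ s)) t (1 : ℝ)) u
              + differential (cotangentModel E) H (legendre l (jetOne γ t)) u = 0 := by
  have hrange (v : TangentBundle 𝓘(ℝ, E) Q) :
      ∀ u ∈ tangentSpaceTo (cotangentModel E) (primaryConstraintSet l) (legendre l v),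
        ∃ w, mfderiv 𝓘(ℝ, E).tangent (cotangentModel E) (legendre l) v w = u :=
    fun u hu => (hsub v).symm.subset hu
  obtain ⟨H₀, hH₀, hH₀e⟩ := hP.exists_contMDiff_extension hP_closed (contMDiff_legendre hl)
    (contMDiff_energy hl) (fun v w hvw => by rw [he, he]; simp only [hvw]) hrange
  refine ⟨⟨H₀, hH₀, ?_⟩, fun H hH hHh J hJ γ hγ t ht => ?_⟩
  · rintro ⟨_, v, rfl⟩
    rw [hH₀e, he]
  have hmem := hγ.jetOne_mem_initialDataConstraint hJ ht
  refine ⟨⟨_, hmem, rfl⟩, hγ.mdifferentiableAt_legendre_jetOne hl hJ ht,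
    hγ.mfderiv_legendre_jetOne_mem hl hJ ht, fun u hu => ?_⟩
  have hHH₀ : differential (cotangentModel E) H (legendre l (jetOne γ t)) u =
      differential (cotangentModel E) H₀ (legendre l (jetOne γ t)) u := by
    -- `H` and `H₀` need only agree on `𝒞`: a vector of `T𝒞` annihilates their difference.
    have hd := hu (fun x => H x - H₀ x) (hH.sub hH₀) (by
      rintro _ ⟨w, hw, rfl⟩
      rw [hH₀e, he, hHh ⟨_, Set.mem_range_self w⟩ ⟨w, hw, rfl⟩, sub_self])
    have hsubd := mfderiv_sub (hH.mdifferentiableAt (x := legendre l (jetOne γ t)) (by simp))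
      (hH₀.mdifferentiableAt (x := legendre l (jetOne γ t)) (by simp))
    have := (DFunLike.congr_fun hsubd u).symm.trans hd
    exact sub_eq_zero.1 this
  -- `T𝒞 ⊆ T𝒫`, and the lift is taken at the jet itself, since the submersion property holds at
  -- every point of the fibre of `ℒ`.
  obtain ⟨w, rfl⟩ := hrange (jetOne γ t) u fun f hf h0 => hu f hf fun x hx =>
    h0 x (Set.image_subset_range _ _ hx)
  have hchain : differential (cotangentModel E) H₀ (legendre l (jetOne γ t))
      (mfderiv 𝓘(ℝ, E).tangent (cotangentModel E) (legendre l) (jetOne γ t) w) =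
      differential 𝓘(ℝ, E).tangent (energy l) (jetOne γ t) w := by
    have hcomp : energy l = H₀ ∘ legendre l := funext fun v => (hH₀e v).symm
    rw [differential, differential, hcomp]
    exact (mfderiv_comp_apply (v := w) (jetOne γ t) (hH₀.mdifferentiableAt (by simp))
      ((contMDiff_legendre hl).mdifferentiableAt (by simp))).symm
  rw [hHH₀, hchain]
  exact hγ.symplecticForm_add_differential_energy hl hJ ht w
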